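/- **Theorem 3.5.** Let $\varepsilon\in\{0,\tfrac12\}$, and let $\mathcal{SV}(\varepsilon)$ be the Schrödinger–Virasoro Lie algebra, that is, the complex Lie algebra with basis $\{L_i, Y_j, M_i : i\in\mathbb Z,\ j\in\varepsilon+\mathbb Z\}$ and brackets $$[L_m,L_n]=(m-n)L_{m+n},\quad [L_m,Y_n]=\left(\tfrac m2-n\right)Y_{m+n},\quad [L_m,M_n]=-nM_{m+n},$$ $$[Y_m,Y_n]=(m-n)M_{m+n},\quad [Y_m,M_n]=[M_m,M_n]=0.$$ A bilinear map $f:\mathcal{SV}(\varepsilon)\times\mathcal{SV}(\varepsilon)\to\mathcal{SV}(\varepsilon)$ is called a biderivation if $$f([x,y],z)=[x,f(y,z)]+[f(x,z),y]\quad\text{and}\quad f(x,[y,z])=[f(x,y),z]+[y,f(x,z)]$$ for all $x,y,z$; it is called inner if there is $\lambda\in\mathbb C$ with $f(x,y)=\lambda[x,y]$ for all $x,y$, and skew-symmetric if $f(x,y)=-f(y,x)$ for all $x,y$. For a family $\Omega=(\mu_i)_{i\in\mathbb Z}$ of complex numbers of which only finitely many are nonzero, let $\chi_\Omega$ be the symmetric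 bilinear map on $\mathcal{SV}(\varepsilon)$ with $$\chi_\Omega(L_m,L_n)=\sum_{i\in\mathbb Z}\mu_i M_{m+n+i}\qquad(m,n\in\mathbb Z)$$ and $\chi_\Omega(x,y)=0$ whenever $x$ or $y$ lies in the span of the $Y_j$ or in the span of the $M_i$. Then a bilinear map $f$ on $\mathcal{SV}(\varepsilon)$ is a biderivation if and only if there are $\lambda\in\mathbb C$ and a family $\Omega=(\mu_i)_{i\in\mathbb Z}$ with only finitely many nonzero members such that $$f(x,y)=\lambda[x,y]+\chi_\Omega(x,y)\qquad\text{for all } x,y\in\mathcal{SV}(\varepsilon).$$ In particular, there is a biderivation of $\mathcal{SV}(\varepsilon)$ that is neither inner nor skew-symmetric. -/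

import Mathlib

noncomputable section

/-- The parameter `ε ∈ {0, 1/2}`. -/
inductive Eps : Type
  | zero : Eps
  | half : Eps

/-- The number `ε`, as a complex number. -/
def Eps.val : Eps → ℂ
  | .zero => 0
  | .half => 1 / 2

/-- The integer `2ε`. -/
def Eps.twice : Eps → ℤ
  | .zero => 0
  | .half => 1

theorem Eps.twice_cast (ε : Eps) : (ε.twice : ℂ) = 2 * ε.val := by
  cases ε <;> simp [Eps.twice, Eps.val]

/-- Labels of the basis vectors of `SV(ε)`: `L m` stands for `L_m`, `M m` for `M_m`,
and `Y k` for `Y_{ε+k}`, where `m` and `k` run over the integers. -/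
inductive SVIndex : Type
  | L (m : ℤ) : SVIndex
  | Y (k : ℤ) : SVIndex
  | M (m : ℤ) : SVIndex

/-- The Schrödinger–Virasoro Lie algebra: the complex vector space with basis
`L_m`, `Y_{ε+k}`, `M_m` (`m`, `k` integers). -/
def SV (_ε : Eps) : Type := SVIndex →₀ ℂ

namespace SV

variable {ε : Eps}

instance : AddCommGroup (SV ε) := inferInstanceAs (AddCommGroup (SVIndex →₀ ℂ))

instance : Module ℂ (SV ε) := inferInstanceAs (Module ℂ (SVIndex →₀ ℂ))

/-- The standard basis of `SV(ε)`. -/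
def basis (ε : Eps) : Module.Basis SVIndex ℂ (SV ε) :=
  Module.Basis.ofRepr (LinearEquiv.refl ℂ (SVIndex →₀ ℂ))

/-- The basis vector `L_m`. -/
def L (ε : Eps) (m : ℤ) : SV ε := basis ε (SVIndex.L m)

/-- The basis vector `Y_{ε+k}`. -/
def Y (ε : Eps) (k : ℤ) : SV ε := basis ε (SVIndex.Y k)

/-- The basis vector `M_m`. -/
def M (ε : Eps) (m : ℤ) : SV ε := basis ε (SVIndex.M m)

/-- The bracket of two basis vectors. With `j = ε + k` and `j' = ε + k'` one has
`[Y_j, Y_j'] = (j - j') M_{j+j'}`, where `j - j' = k - k'` and `j + j' = 2ε + k + k'`. -/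
def basisBracket (ε : Eps) : SVIndex → SVIndex → SV ε
  | .L m, .L n => ((m : ℂ) - n) • L ε (m + n)
  | .L m, .Y k => ((m : ℂ) / 2 - (ε.val + k)) • Y ε (m + k)
  | .L m, .M n => (-(n : ℂ)) • M ε (m + n)
  | .Y k, .L m => (-((m : ℂ) / 2 - (ε.val + k))) • Y ε (m + k)
  | .Y k, .Y k' => ((k : ℂ) - k') • M ε (ε.twice + k + k')
  | .Y _, .M _ => 0
  | .M n, .L m => (n : ℂ) • M ε (m + n)
  | .M _, .Y _ => 0
  | .M _, .M _ => 0

/-- The bilinear extension of the bracket of basis vectors. -/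
def bracketHom (ε : Eps) : SV ε →ₗ[ℂ] SV ε →ₗ[ℂ] SV ε :=
  (basis ε).constr ℂ fun i => (basis ε).constr ℂ fun j => basisBracket ε i j

theorem bracketHom_basis (i j : SVIndex) :
    bracketHom ε (basis ε i) (basis ε j) = basisBracket ε i j := by
  simp [bracketHom, Module.Basis.constr_basis]

theorem bracketHom_skew (x y : SV ε) : bracketHom ε x y = -bracketHom ε y x := by
  have h : bracketHom ε = -(bracketHom ε).flip := by
    refine (basis ε).ext fun i => (basis ε).ext fun j => ?_
    simp only [LinearMap.neg_apply, LinearMap.flip_apply, bracketHom_basis]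
    rcases i with m | m | m <;> rcases j with n | n | n <;>
      simp only [basisBracket, neg_zero, neg_neg, ← neg_smul]
    · rw [add_comm n m]; congr 1; ring
    · rw [add_right_comm]; congr 1; ring
  simpa using LinearMap.congr_fun (LinearMap.congr_fun h x) y

theorem smul_basis_eq {i j k : SVIndex} {a b c : ℂ} (hj : j = i) (hk : k = i)
    (h : a = b + c) : a • basis ε i = b • basis ε j + c • basis ε k := by
  rw [hj, hk, h, add_smul]

theorem bracketHom_jacobi (x y z : SV ε) :
    bracketHom ε x (bracketHom ε y z) =
      bracketHom ε (bracketHom ε x y) z + bracketHom ε y (bracketHom ε x z) := by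
  have key : ∀ i j k : SVIndex,
      bracketHom ε (basis ε i) (bracketHom ε (basis ε j) (basis ε k)) =
        bracketHom ε (bracketHom ε (basis ε i) (basis ε j)) (basis ε k) +
          bracketHom ε (basis ε j) (bracketHom ε (basis ε i) (basis ε k)) := by
    have h2 := ε.twice_cast
    intro i j k
    simp only [bracketHom_basis]
    rcases i with m | m | m <;> rcases j with n | n | n <;> rcases k with p | p | p <;>
      simp only [basisBracket, L, Y, M, map_smul, map_zero, LinearMap.smul_apply,
        LinearMap.zero_apply, bracketHom_basis, smul_smul, smul_zero, add_zero] <;>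
      refine smul_basis_eq (by congr 1; ring) (by congr 1; ring) ?_ <;>
      push_cast <;> try simp only [h2]
    all_goals ring
  have h1 : ∀ i j : SVIndex, bracketHom ε (basis ε i) ∘ₗ bracketHom ε (basis ε j) =
      bracketHom ε (bracketHom ε (basis ε i) (basis ε j)) +
        bracketHom ε (basis ε j) ∘ₗ bracketHom ε (basis ε i) :=
    fun i j => (basis ε).ext fun k => key i j k
  have h2 : ∀ i : SVIndex, bracketHom ε (basis ε i) ∘ₗ (bracketHom ε).flip z =
      (bracketHom ε).flip z ∘ₗ bracketHom ε (basis ε i) +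
        (bracketHom ε).flip (bracketHom ε (basis ε i) z) :=
    fun i => (basis ε).ext fun j => LinearMap.congr_fun (h1 i j) z
  have h3 : (bracketHom ε).flip (bracketHom ε y z) =
      (bracketHom ε).flip z ∘ₗ (bracketHom ε).flip y +
        bracketHom ε y ∘ₗ (bracketHom ε).flip z :=
    (basis ε).ext fun i => LinearMap.congr_fun (h2 i) y
  exact LinearMap.congr_fun h3 x

instance : LieRing (SV ε) where
  bracket x y := bracketHom ε x y
  add_lie x y z := LinearMap.map_add₂ (bracketHom ε) x y z
  lie_add x y z := map_add (bracketHom ε x) y z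
  lie_self x := by
    have : IsAddTorsionFree (SV ε) := .of_isTorsionFree ℂ (SV ε)
    exact self_eq_neg.mp (bracketHom_skew x x)
  leibniz_lie x y z := bracketHom_jacobi x y z

instance : LieAlgebra ℂ (SV ε) where
  lie_smul c x y := map_smul (bracketHom ε x) c y

theorem lie_L_L (m n : ℤ) : ⁅L ε m, L ε n⁆ = ((m : ℂ) - n) • L ε (m + n) :=
  bracketHom_basis _ _

theorem lie_L_Y (m k : ℤ) : ⁅L ε m, Y ε k⁆ = ((m : ℂ) / 2 - (ε.val + k)) • Y ε (m + k) :=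
  bracketHom_basis _ _

theorem lie_L_M (m n : ℤ) : ⁅L ε m, M ε n⁆ = (-(n : ℂ)) • M ε (m + n) :=
  bracketHom_basis _ _

theorem lie_Y_Y (k k' : ℤ) :
    ⁅Y ε k, Y ε k'⁆ = ((k : ℂ) - k') • M ε (ε.twice + k + k') :=
  bracketHom_basis _ _

theorem lie_Y_M (k n : ℤ) : ⁅Y ε k, M ε n⁆ = 0 :=
  bracketHom_basis _ _

theorem lie_M_M (m n : ℤ) : ⁅M ε m, M ε n⁆ = 0 :=
  bracketHom_basis _ _

/-- The values of `χ_μ` on basis vectors: `χ_μ(L_m, L_n) = ∑ i, μ_i M_{m+n+i}`, and `0` on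
all other pairs. -/
def chiBasis (ε : Eps) (μ : ℤ →₀ ℂ) : SVIndex → SVIndex → SV ε
  | .L m, .L n => μ.sum fun i c => c • M ε (m + n + i)
  | _, _ => 0

/-- The bilinear map `χ_μ` attached to a finitely supported family `μ` of complex numbers. -/
def chi (ε : Eps) (μ : ℤ →₀ ℂ) : SV ε →ₗ[ℂ] SV ε →ₗ[ℂ] SV ε :=
  (basis ε).constr ℂ fun i => (basis ε).constr ℂ fun j => chiBasis ε μ i j

theorem chi_basis (μ : ℤ →₀ ℂ) (i j : SVIndex) :
    chi ε μ (basis ε i) (basis ε j) = chiBasis ε μ i j := by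
  simp [chi, Module.Basis.constr_basis]

theorem chi_L_L (μ : ℤ →₀ ℂ) (m n : ℤ) :
    chi ε μ (L ε m) (L ε n) = μ.sum fun i c => c • M ε (m + n + i) :=
  chi_basis μ _ _

theorem chi_symm (μ : ℤ →₀ ℂ) (x y : SV ε) : chi ε μ x y = chi ε μ y x := by
  have h : chi ε μ = (chi ε μ).flip := by
    refine (basis ε).ext fun i => (basis ε).ext fun j => ?_
    simp only [LinearMap.flip_apply, chi_basis]
    rcases i with m | m | m <;> rcases j with n | n | n <;> simp only [chiBasis, add_comm n m]
  exact LinearMap.congr_fun (LinearMap.congr_fun h x) y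

theorem chi_Y_left (μ : ℤ →₀ ℂ) (k : ℤ) (y : SV ε) : chi ε μ (Y ε k) y = 0 := by
  have h : chi ε μ (Y ε k) = 0 := (basis ε).ext fun j => chi_basis μ _ j
  rw [h, LinearMap.zero_apply]

theorem chi_M_left (μ : ℤ →₀ ℂ) (m : ℤ) (y : SV ε) : chi ε μ (M ε m) y = 0 := by
  have h : chi ε μ (M ε m) = 0 := (basis ε).ext fun j => chi_basis μ _ j
  rw [h, LinearMap.zero_apply]

end SV

section Biderivation

variable {K A : Type*} [CommRing K] [LieRing A] [LieAlgebra K A]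

/-- A bilinear map on a Lie algebra is a biderivation if it is a derivation in each argument. -/
def IsBiderivation (f : A →ₗ[K] A →ₗ[K] A) : Prop :=
  (∀ x y z : A, f ⁅x, y⁆ z = ⁅x, f y z⁆ + ⁅f x z, y⁆) ∧
    ∀ x y z : A, f x ⁅y, z⁆ = ⁅f x y, z⁆ + ⁅y, f x z⁆

/-- Inner biderivations: the scalar multiples of the Lie bracket. -/
def IsInnerBiderivation (f : A →ₗ[K] A →ₗ[K] A) : Prop :=
  ∃ c : K, ∀ x y : A, f x y = c • ⁅x, y⁆

/-- Skew-symmetric bilinear maps. -/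
def IsSkewSymmetric (f : A →ₗ[K] A →ₗ[K] A) : Prop :=
  ∀ x y : A, f x y = -f y x

end Biderivation

end

/-! A biderivation is determined by its value at `(L_0, L_0)` and a single number, the
`L_1`-coordinate of its value at `(L_0, L_1)` (`biderivation_eq_zero`). The value at `(L_0, L_0)`
has only `M`-components (`coord_biderivation_L_zero`), and these are matched by a unique `chi ε μ`.
The number is matched by a multiple of the bracket, which vanishes at `(L_0, L_0)`, while `chi` has
no `L`-components. Subtracting both leaves zero.

The rigidity comes from the grading. Since `ad L_0` is diagonal, expanding `f([L_0, e_j], z)`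
expresses every coordinate of `f(e_j, z)` outside the degree of `e_j` through `f(L_0, z)`; the same
holds on the right. Computing one coordinate of `f(L_m, L_n)` from both sides then kills `f(L_0,
L_n)` and `f(L_n, L_0)`, next all of `f(L_0, ·)` and `f(·, L_0)`, and finally `f`. Where equal
degrees block the division, a basis vector is rewritten as a multiple of some `[L_a, e]`. -/

/-! ### Uniform description of the basis by slope and degree -/

/-- The index `i` with its label raised by `n`. -/
def SVIndex.shift (n : ℤ) : SVIndex → SVIndex
  | .L m => .L (m + n)
  | .Y k => .Y (k + n)
  | .M m => .M (m + n)

/-- The coefficient `s` for which `[L_n, e_i] = (s n - deg i) e_{i+n}`. -/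
noncomputable def SVIndex.slope : SVIndex → ℂ
  | .L _ => 1
  | .Y _ => 1 / 2
  | .M _ => 0

/-- The degree of a basis vector: `m` for `L_m` and `M_m`, and `ε + k` for `Y_{ε+k}`. -/
noncomputable def SVIndex.deg (ε : Eps) : SVIndex → ℂ
  | .L m => m
  | .Y k => ε.val + k
  | .M m => m

namespace SVIndex

@[simp] theorem shift_zero (i : SVIndex) : i.shift 0 = i := by
  cases i <;> simp [shift]

@[simp] theorem shift_shift (m n : ℤ) (i : SVIndex) :
    (i.shift m).shift n = i.shift (m + n) := by
  cases i <;> simp [shift, add_assoc]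

@[simp] theorem slope_shift (n : ℤ) (i : SVIndex) : (i.shift n).slope = i.slope := by
  cases i <;> rfl

@[simp] theorem deg_shift (ε : Eps) (n : ℤ) (i : SVIndex) :
    (i.shift n).deg ε = i.deg ε + n := by
  cases i <;> simp [shift, deg, add_assoc]

theorem shift_injective (n : ℤ) : Function.Injective (shift n) := by
  intro i j h
  simpa using congrArg (shift (-n)) h

theorem slope_add_one_ne_zero (i : SVIndex) : i.slope + 1 ≠ 0 := by
  cases i <;> norm_num [slope]

/-- Every basis vector is a nonzero multiple of some `[L_a, e]` with `a` different from zero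
and from the degree. -/
theorem exists_lowering (ε : Eps) (i : SVIndex) :
    ∃ a : ℤ, (a : ℂ) ≠ 0 ∧ (a : ℂ) ≠ i.deg ε ∧ (i.slope + 1) * a - i.deg ε ≠ 0 := by
  have hs := i.slope_add_one_ne_zero
  generalize i.slope + 1 = t at hs ⊢
  generalize i.deg ε = d
  -- At most one of `a = 1, 2, 3` equals `d`. If the claim fails, `t * a = d` at two others, which
  -- forces `t = 0`.
  by_contra! h
  have h1 := h 1 (by norm_num)
  have h2 := h 2 (by norm_num)
  have h3 := h 3 (by norm_num)
  push_cast at h1 h2 h3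
  apply hs
  by_cases hd : (1 : ℂ) = d
  · subst hd
    linear_combination h3 (by norm_num) - h2 (by norm_num)
  by_cases hd' : (2 : ℂ) = d
  · subst hd'
    linear_combination (h3 (by norm_num) - h1 (by norm_num)) / 2
  · linear_combination h2 hd' - h1 hd

end SVIndex

/-! ### Coordinates and the action of `L_n` -/

namespace SV

open SVIndex

variable {ε : Eps}

theorem lie_L_basis (n : ℤ) (i : SVIndex) :
    ⁅L ε n, basis ε i⁆ = (i.slope * n - i.deg ε) • basis ε (i.shift n) := by
  cases i with
  | L m =>
    rw [show SVIndex.slope (.L m) * n - deg ε (.L m) = (n : ℂ) - m by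
      simp only [SVIndex.slope, deg]; ring, shift, add_comm m n]
    exact lie_L_L n m
  | Y k =>
    rw [show SVIndex.slope (.Y k) * n - deg ε (.Y k) = (n : ℂ) / 2 - (ε.val + k) by
      simp only [SVIndex.slope, deg]; ring, shift, add_comm k n]
    exact lie_L_Y n k
  | M m =>
    rw [show SVIndex.slope (.M m) * n - deg ε (.M m) = -(m : ℂ) by
      simp only [SVIndex.slope, deg]; ring, shift, add_comm m n]
    exact lie_L_M n m

/-- The coordinate of a vector at a basis index. -/
noncomputable def coord (i : SVIndex) : SV ε →ₗ[ℂ] ℂ := (basis ε).coord i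

theorem coord_basis_self (i : SVIndex) : coord i (basis ε i) = 1 := by
  simp [coord]

theorem coord_basis_ne {i j : SVIndex} (h : j ≠ i) : coord i (basis ε j) = 0 := by
  simp [coord, h]

theorem ext_coord {x y : SV ε} (h : ∀ i, coord i x = coord i y) : x = y :=
  (basis ε).ext_elem h

theorem coord_shift_lie_L (n : ℤ) (i : SVIndex) (x : SV ε) :
    coord (i.shift n) ⁅L ε n, x⁆ = (i.slope * n - i.deg ε) * coord i x := by
  have h : coord (i.shift n) ∘ₗ bracketHom ε (L ε n) =
      (i.slope * n - i.deg ε) • coord (ε := ε) i := by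
    refine (basis ε).ext fun j => ?_
    change coord (i.shift n) ⁅L ε n, basis ε j⁆ = _ * coord i (basis ε j)
    rw [lie_L_basis, map_smul]
    by_cases hj : j = i
    · subst hj; simp [coord_basis_self]
    · rw [coord_basis_ne hj, coord_basis_ne ((shift_injective n).ne hj)]; simp
  exact LinearMap.congr_fun h x

/-- The contributing basis vector has degree `deg i - n`, which turns the slope into `slope + 1`. -/
theorem coord_lie_L (n : ℤ) (i : SVIndex) (x : SV ε) :
    coord i ⁅L ε n, x⁆ = ((i.slope + 1) * n - i.deg ε) * coord (i.shift (-n)) x := by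
  have h := coord_shift_lie_L n (i.shift (-n)) x
  simp only [shift_shift, neg_add_cancel, shift_zero, slope_shift, deg_shift] at h
  rw [h]; push_cast; ring

theorem coord_lie_L_zero (i : SVIndex) (x : SV ε) :
    coord i ⁅L ε 0, x⁆ = -i.deg ε * coord i x := by
  simpa using coord_lie_L 0 i x

theorem lie_L_zero_basis (i : SVIndex) :
    ⁅L ε 0, basis ε i⁆ = -i.deg ε • basis ε i := by
  simpa using lie_L_basis (ε := ε) 0 i

end SV

/-! ### Biderivations of a general Lie algebra -/

namespace IsBiderivation

section General

variable {K A : Type*} [CommRing K] [LieRing A] [LieAlgebra K A] {f g : A →ₗ[K] A →ₗ[K] A}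

theorem flip (hf : IsBiderivation f) : IsBiderivation f.flip := by
  refine ⟨fun x y z => ?_, fun x y z => ?_⟩
  · simp only [LinearMap.flip_apply, hf.2 z x y]; exact add_comm _ _
  · simp only [LinearMap.flip_apply, hf.1 y z x]; exact add_comm _ _

theorem add (hf : IsBiderivation f) (hg : IsBiderivation g) : IsBiderivation (f + g) := by
  refine ⟨fun x y z => ?_, fun x y z => ?_⟩
  · simp only [LinearMap.add_apply, hf.1 x y z, hg.1 x y z, lie_add, add_lie]; abel
  · simp only [LinearMap.add_apply, hf.2 x y z, hg.2 x y z, lie_add, add_lie]; abel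

theorem smul (c : K) (hf : IsBiderivation f) : IsBiderivation (c • f) := by
  refine ⟨fun x y z => ?_, fun x y z => ?_⟩
  · simp only [LinearMap.smul_apply, hf.1 x y z, lie_smul, smul_lie, smul_add]
  · simp only [LinearMap.smul_apply, hf.2 x y z, lie_smul, smul_lie, smul_add]

theorem sub (hf : IsBiderivation f) (hg : IsBiderivation g) : IsBiderivation (f - g) := by
  have h := hf.add (hg.smul (-1))
  rwa [show f + (-1 : K) • g = f - g by module] at h

/-- Expanding `f ([x, u], [x, v])` in both orders. -/
theorem lie_diag (hf : IsBiderivation f) (x u v : A) :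
    ⁅f x x, ⁅u, v⁆⁆ = ⁅f u x, ⁅x, v⁆⁆ - ⁅⁅u, x⁆, f x v⁆ := by
  have h := hf.1 x u ⁅x, v⁆
  rw [hf.2 u x v, hf.2 x x v, hf.2 ⁅x, u⁆ x v, hf.1 x u x, hf.1 x u v] at h
  simp only [lie_add, add_lie] at h
  have h1 := leibniz_lie x (f u x) v
  have h2 := leibniz_lie x (f x v) u
  have h3 : ⁅f x v, ⁅x, u⁆⁆ = ⁅⁅u, x⁆, f x v⁆ := by
    rw [← lie_skew ⁅u, x⁆ (f x v), ← lie_skew u x, lie_neg, neg_neg]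
  rw [leibniz_lie (f x x) u v, ← lie_skew u ⁅f x x, v⁆, ← h3]
  -- By now `f u v` enters both sides only through the same double bracket with `x`; Jacobi
  -- rearranges the remaining terms.
  rw [h1, h2] at h
  rw [← sub_eq_zero] at h ⊢
  rw [← h]
  abel

end General

end IsBiderivation

/-! ### The bracket and `chi` are biderivations -/

namespace SV

open SVIndex

variable {ε : Eps}

theorem isBiderivation_bracketHom : IsBiderivation (bracketHom ε) := by
  refine ⟨fun x y z => ?_, fun x y z => ?_⟩
  · change ⁅⁅x, y⁆, z⁆ = ⁅x, ⁅y, z⁆⁆ + ⁅⁅x, z⁆, y⁆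
    rw [lie_lie, ← lie_skew y ⁅x, z⁆]; abel
  · exact leibniz_lie x y z

/-- Both brackets land on `M_{a+b+c+i}`, with coefficients `-(b+c+i)` and `-(a+c+i)`, whose
difference is `a - b`. -/
theorem lie_chi_L_L (μ : ℤ →₀ ℂ) (a b c : ℤ) :
    ((a : ℂ) - b) • chi ε μ (L ε (a + b)) (L ε c) =
      ⁅L ε a, chi ε μ (L ε b) (L ε c)⁆ - ⁅L ε b, chi ε μ (L ε a) (L ε c)⁆ := by
  simp only [chi_L_L, Finsupp.sum, lie_sum, lie_smul, lie_L_M, Finset.smul_sum,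
    ← Finset.sum_sub_distrib]
  refine Finset.sum_congr rfl fun i _ => ?_
  rw [show a + (b + c + i) = a + b + c + i by ring, show b + (a + c + i) = a + b + c + i by ring]
  simp only [smul_smul, ← sub_smul]
  congr 1
  push_cast
  ring

theorem lie_Y_chi (μ : ℤ →₀ ℂ) (k m n : ℤ) : ⁅Y ε k, chi ε μ (L ε m) (L ε n)⁆ = 0 := by
  simp only [chi_L_L, Finsupp.sum, lie_sum, lie_smul, lie_Y_M, smul_zero, Finset.sum_const_zero]

theorem lie_M_chi (μ : ℤ →₀ ℂ) (k m n : ℤ) : ⁅M ε k, chi ε μ (L ε m) (L ε n)⁆ = 0 := by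
  simp only [chi_L_L, Finsupp.sum, lie_sum, lie_smul, lie_M_M, smul_zero, Finset.sum_const_zero]

theorem chi_Y_right (μ : ℤ →₀ ℂ) (k : ℤ) (x : SV ε) : chi ε μ x (Y ε k) = 0 := by
  rw [chi_symm, chi_Y_left]

theorem chi_M_right (μ : ℤ →₀ ℂ) (k : ℤ) (x : SV ε) : chi ε μ x (M ε k) = 0 := by
  rw [chi_symm, chi_M_left]

theorem induction_basis {P : SV ε → Prop} (h : ∀ i, P (basis ε i))
    (hadd : ∀ x y, P x → P y → P (x + y)) (hsmul : ∀ (c : ℂ) x, P x → P (c • x)) (x : SV ε) :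
    P x := by
  have hx : x ∈ Submodule.span ℂ (Set.range (basis ε)) := by
    rw [(basis ε).span_eq]; exact Submodule.mem_top
  induction hx using Submodule.span_induction with
  | mem x hx => obtain ⟨i, rfl⟩ := hx; exact h i
  | zero => simpa using hsmul 0 _ (h (.L 0))
  | add x y _ _ hx hy => exact hadd x y hx hy
  | smul c x _ hx => exact hsmul c x hx

theorem chi_lie_basis (μ : ℤ →₀ ℂ) (i j k : SVIndex) :
    chi ε μ ⁅basis ε i, basis ε j⁆ (basis ε k) =
      ⁅basis ε i, chi ε μ (basis ε j) (basis ε k)⁆ +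
        ⁅chi ε μ (basis ε i) (basis ε k), basis ε j⁆ := by
  have hL : ∀ m, basis ε (.L m) = L ε m := fun _ => rfl
  have hY : ∀ m, basis ε (.Y m) = Y ε m := fun _ => rfl
  have hM : ∀ m, basis ε (.M m) = M ε m := fun _ => rfl
  have lie_Y_L : ∀ a b, chi ε μ ⁅Y ε a, L ε b⁆ = 0 := fun a b => by
    ext z; rw [← lie_skew, lie_L_Y, map_neg, map_smul]; simp [chi_Y_left]
  have lie_M_L : ∀ a b, chi ε μ ⁅M ε a, L ε b⁆ = 0 := fun a b => by
    ext z; rw [← lie_skew, lie_L_M, map_neg, map_smul]; simp [chi_M_left]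
  have lie_M_Y : ∀ a b, ⁅M ε a, Y ε b⁆ = 0 := fun a b => by
    rw [← lie_skew, lie_Y_M, neg_zero]
  rw [← lie_skew (chi ε μ _ _) (basis ε j)]
  rcases i with a | a | a <;> rcases j with b | b | b <;> rcases k with c | c | c <;>
    simp only [hL, hY, hM, lie_Y_L, lie_M_L, lie_M_Y, lie_L_L, lie_L_Y, lie_L_M, lie_Y_Y, lie_Y_M,
      lie_M_M, map_smul, map_zero, LinearMap.smul_apply, LinearMap.zero_apply, chi_Y_left,
      chi_M_left, chi_Y_right, chi_M_right, lie_Y_chi, lie_M_chi, smul_zero, lie_zero, neg_zero,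
      add_zero]
  rw [lie_chi_L_L, sub_eq_add_neg]

theorem isBiderivation_chi (μ : ℤ →₀ ℂ) : IsBiderivation (chi ε μ) := by
  have key : ∀ x y z, chi ε μ ⁅x, y⁆ z = ⁅x, chi ε μ y z⁆ + ⁅chi ε μ x z, y⁆ := by
    intro x y z
    induction x using induction_basis with
    | h i =>
      induction y using induction_basis with
      | h j =>
        induction z using induction_basis with
        | h k => exact chi_lie_basis μ i j k
        | hadd x y hx hy => simp only [map_add, lie_add, add_lie, hx, hy]; abel
        | hsmul c x hx => simp only [map_smul, lie_smul, smul_lie, hx, smul_add]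
      | hadd x y hx hy =>
        simp only [map_add, LinearMap.add_apply, lie_add, hx, hy]; abel
      | hsmul c x hx =>
        simp only [map_smul, LinearMap.smul_apply, lie_smul, hx, smul_add]
    | hadd x y hx hy => simp only [map_add, LinearMap.add_apply, add_lie, hx, hy]; abel
    | hsmul c x hx =>
      simp only [map_smul, LinearMap.smul_apply, smul_lie, hx, smul_add]
  refine ⟨key, fun x y z => ?_⟩
  rw [chi_symm, key, chi_symm μ z x, chi_symm μ y x, add_comm]

/-! ### Rigidity of biderivations -/

variable {f : SV ε →ₗ[ℂ] SV ε →ₗ[ℂ] SV ε}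

theorem coord_lie_L_right (n : ℤ) (i : SVIndex) (x : SV ε) :
    coord i ⁅x, L ε n⁆ = (i.deg ε - (i.slope + 1) * n) * coord (i.shift (-n)) x := by
  rw [← lie_skew, map_neg, coord_lie_L]; ring

theorem coord_shift_lie_L_right (n : ℤ) (i : SVIndex) (x : SV ε) :
    coord (i.shift n) ⁅x, L ε n⁆ = (i.deg ε - i.slope * n) * coord i x := by
  rw [← lie_skew, map_neg, coord_shift_lie_L]; ring

/-- `ad L_0` scales `e_j` by `-deg j` and the `i`-th coordinate by `-deg i`. -/
theorem coord_biderivation_left (hf : IsBiderivation f) (i j : SVIndex) (z : SV ε) :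
    (i.deg ε - j.deg ε) * coord i (f (basis ε j) z) = coord i ⁅f (L ε 0) z, basis ε j⁆ := by
  have h := congrArg (coord i) (hf.1 (L ε 0) (basis ε j) z)
  rw [lie_L_zero_basis, map_smul, LinearMap.smul_apply, map_smul, map_add, coord_lie_L_zero,
    smul_eq_mul] at h
  linear_combination h

theorem coord_biderivation_right (hf : IsBiderivation f) (i j : SVIndex) (y : SV ε) :
    (i.deg ε - j.deg ε) * coord i (f y (basis ε j)) = coord i ⁅f y (L ε 0), basis ε j⁆ :=
  coord_biderivation_left hf.flip i j y

/-- The value at `(L_0, L_0)` lies in the span of the `M_i`. -/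
theorem coord_biderivation_L_zero (hf : IsBiderivation f) {i : SVIndex} (hi : i.slope ≠ 0) :
    coord i (f (L ε 0) (L ε 0)) = 0 := by
  have h := congrArg (coord i) (hf.lie_diag (L ε 0) (L ε 1) (L ε (-1)))
  have hE := coord_biderivation_left hf (i.shift 1) (.L 1) (L ε 0)
  have hD := coord_biderivation_right hf (i.shift (-1)) (.L (-1)) (L ε 0)
  change _ * coord _ (f (L ε 1) _) = coord _ ⁅_, L ε 1⁆ at hE
  change _ * coord _ (f _ (L ε (-1))) = coord _ ⁅_, L ε (-1)⁆ at hD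
  rw [coord_shift_lie_L_right, deg_shift, deg] at hE hD
  simp only [lie_L_L, lie_smul, smul_lie, map_smul, map_sub, smul_eq_mul] at h
  norm_num [coord_lie_L_right, coord_lie_L] at h
  push_cast at hE hD
  -- Multiplying `h` by the degree lets `hE` and `hD` eliminate the other two coordinates. The
  -- degree then cancels, so degree zero is no exception.
  have key : i.slope * (i.slope + 1) * coord i (f (L ε 0) (L ε 0)) = 0 := by
    linear_combination (i.deg ε * h + (i.slope + 1 + i.deg ε) * hE -
      (i.slope + 1 - i.deg ε) * hD) / 2
  simpa [hi, i.slope_add_one_ne_zero] using key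

theorem coord_biderivation_L_zero_left (hf : IsBiderivation f) (h0 : f (L ε 0) (L ε 0) = 0)
    {i j : SVIndex} (hij : i.deg ε ≠ j.deg ε) : coord i (f (L ε 0) (basis ε j)) = 0 := by
  have h := coord_biderivation_right hf i j (L ε 0)
  rw [h0, zero_lie, map_zero] at h
  exact (mul_eq_zero.mp h).resolve_left (sub_ne_zero.mpr hij)

theorem coord_biderivation_L_eq_zero (hf : IsBiderivation f) (h0 : f (L ε 0) (L ε 0) = 0)
    (h1 : coord (.L 1) (f (L ε 0) (L ε 1)) = 0) {i : SVIndex} (hi : i.deg ε = 0) (n : ℤ) :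
    coord (i.shift n) (f (L ε 0) (L ε n)) = 0 ∧ coord (i.shift n) (f (L ε n) (L ε 0)) = 0 := by
  obtain ⟨a, ha⟩ : ∃ a : ℤ → ℂ, ∀ n, a n = coord (i.shift n) (f (L ε 0) (L ε n)) :=
    ⟨_, fun _ => rfl⟩
  obtain ⟨b, hb⟩ : ∃ b : ℤ → ℂ, ∀ n, b n = coord (i.shift n) (f (L ε n) (L ε 0)) :=
    ⟨_, fun _ => rfl⟩
  rw [← ha, ← hb]
  have ha0 : a 0 = 0 := by rw [ha, h0, map_zero]
  have hb0 : b 0 = 0 := by rw [hb, h0, map_zero]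
  -- The coordinate of `f(L_m, L_n)` at `i.shift (m + n)`, computed from the left and from the
  -- right.
  have hab (m n : ℤ) : m * (n - i.slope * m) * a n = n * (m - i.slope * n) * b m := by
    have hl := coord_biderivation_left hf ((i.shift n).shift m) (.L m) (L ε n)
    have hr := coord_biderivation_right hf ((i.shift m).shift n) (.L n) (L ε m)
    change _ * coord _ (f (L ε m) _) = coord _ ⁅_, L ε m⁆ at hl
    change _ * coord _ (f _ (L ε n)) = coord _ ⁅_, L ε n⁆ at hr
    rw [coord_shift_lie_L_right, deg_shift, deg_shift, hi, slope_shift, shift_shift, deg,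
      ← ha] at hl
    rw [coord_shift_lie_L_right, deg_shift, deg_shift, hi, slope_shift, shift_shift, deg,
      ← hb, add_comm m n] at hr
    linear_combination n * hr - m * hl
  have h2 : a 1 + a (-1) = 0 := by
    have h := congrArg (coord i) (hf.2 (L ε 0) (L ε 1) (L ε (-1)))
    rw [lie_L_L, map_smul, map_add, coord_lie_L_right, coord_lie_L, neg_neg, ← ha, ← ha, hi] at h
    simp only [Int.reduceNeg, add_neg_cancel, h0, smul_zero, map_zero] at h
    push_cast at h
    refine (mul_eq_zero.mp (?_ : (i.slope + 1) * (a 1 + a (-1)) = 0)).resolve_left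
      i.slope_add_one_ne_zero
    linear_combination -h
  have ha1 : a 1 = 0 := by
    -- At slope 1 the bracket itself solves these equations (`a n = -n`, `b n = n`), so only `h1`
    -- excludes it.
    by_cases hs : i.slope = 1
    · have : i = .L 0 := by
        rcases i with m | m | m
        · simp only [deg, Int.cast_eq_zero] at hi; rw [hi]
        · norm_num [SVIndex.slope] at hs
        · norm_num [SVIndex.slope] at hs
      rw [ha, this]; exact h1
    · have h3 := hab 1 1
      have h4 := hab 1 (-1)
      push_cast at h3 h4
      have h5 : (i.slope + 1) * b 1 = 0 := by
        refine (mul_eq_zero.mp (?_ : (1 - i.slope) * ((i.slope + 1) * b 1) = 0)).resolve_left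
          (sub_ne_zero.mpr (Ne.symm hs))
        linear_combination ((1 - i.slope) * h4 + (1 - i.slope) * (1 + i.slope) * h2 -
          (1 + i.slope) * h3) / 2
      have h6 : b 1 = 0 := (mul_eq_zero.mp h5).resolve_left i.slope_add_one_ne_zero
      rw [h6] at h3
      simpa [sub_ne_zero.mpr (Ne.symm hs)] using h3
  have ha1' : a (-1) = 0 := by rwa [ha1, zero_add] at h2
  have hb' (m : ℤ) : b m = 0 := by
    have h3 := hab m 1
    have h4 := hab m (-1)
    rw [ha1] at h3
    rw [ha1'] at h4
    push_cast at h3 h4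
    have h5 : (m : ℂ) * b m = 0 := by linear_combination (h4 - h3) / 2
    rcases mul_eq_zero.mp h5 with h | h
    · rw [Int.cast_eq_zero] at h; rw [h, hb0]
    · exact h
  refine ⟨?_, hb' n⟩
  have h3 := hab 1 n
  have h4 := hab (-1) n
  rw [hb'] at h3 h4
  push_cast at h3 h4
  have h5 : (n : ℂ) * a n = 0 := by linear_combination (h3 - h4) / 2
  rcases mul_eq_zero.mp h5 with h | h
  · rw [Int.cast_eq_zero] at h; rw [h, ha0]
  · exact h

theorem biderivation_L_eq_zero (hf : IsBiderivation f) (h0 : f (L ε 0) (L ε 0) = 0)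
    (h1 : coord (.L 1) (f (L ε 0) (L ε 1)) = 0) (n : ℤ) :
    f (L ε 0) (L ε n) = 0 ∧ f (L ε n) (L ε 0) = 0 := by
  have key (i : SVIndex) :
      coord i (f (L ε 0) (L ε n)) = 0 ∧ coord i (f (L ε n) (L ε 0)) = 0 := by
    by_cases hi : i.deg ε = n
    · have := coord_biderivation_L_eq_zero hf h0 h1 (i := i.shift (-n)) (by simp [hi]) n
      simpa using this
    · exact ⟨coord_biderivation_L_zero_left hf h0 (j := .L n) hi,
        coord_biderivation_L_zero_left hf.flip h0 (j := .L n) hi⟩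
  exact ⟨ext_coord fun i => by rw [(key i).1, map_zero],
    ext_coord fun i => by rw [(key i).2, map_zero]⟩

/-- A derivation `f(L_0, ·)` that kills all `L_n` takes values in the span of `M_0`. -/
theorem coord_biderivation_eq_zero (hf : IsBiderivation f)
    (hl : ∀ n, f (L ε 0) (L ε n) = 0) (hr : ∀ n, f (L ε n) (L ε 0) = 0) {i : SVIndex}
    (hi : i.slope ≠ 0 ∨ i.deg ε ≠ 0) (j : SVIndex) : coord i (f (L ε 0) (basis ε j)) = 0 := by
  by_cases hij : i.deg ε = j.deg ε
  -- For `n ≠ 0` the coordinate of `f(L_n, e_j)` at `i.shift n` vanishes by the right expansion, and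
  -- the left expansion passes this on to `f(L_0, e_j)`.
  · have key (n : ℤ) (hn : (n : ℂ) ≠ 0) :
        (i.deg ε - i.slope * n) * coord i (f (L ε 0) (basis ε j)) = 0 := by
      have h := coord_biderivation_left hf (i.shift n) (.L n) (basis ε j)
      have h' := coord_biderivation_right hf (i.shift n) j (L ε n)
      change _ * coord _ (f (L ε n) _) = coord _ ⁅_, L ε n⁆ at h
      rw [hr, zero_lie, map_zero, deg_shift, hij, add_sub_cancel_left] at h'
      rwa [(mul_eq_zero.mp h').resolve_left hn, mul_zero, coord_shift_lie_L_right, eq_comm] at h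
    have h1 := key 1 (by norm_num)
    have h2 := key (-1) (by norm_num)
    push_cast at h1 h2
    rcases hi with hi | hi
    · exact (mul_eq_zero.mp (by linear_combination (h2 - h1) / 2)).resolve_left hi
    · exact (mul_eq_zero.mp (by linear_combination (h2 + h1) / 2)).resolve_left hi
  · exact coord_biderivation_L_zero_left hf (hl 0) hij

theorem basis_eq_smul_lie (i : SVIndex) : ∃ (a : ℤ) (c : ℂ), (a : ℂ) ≠ 0 ∧ (a : ℂ) ≠ i.deg ε ∧
    basis ε i = c • ⁅L ε a, basis ε (i.shift (-a))⁆ := by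
  obtain ⟨a, ha, had, hc⟩ := exists_lowering ε i
  refine ⟨a, ((i.slope + 1) * a - i.deg ε)⁻¹, ha, had, ?_⟩
  rw [lie_L_basis, eq_inv_smul_iff₀ hc]
  simp only [shift_shift, neg_add_cancel, shift_zero, slope_shift, deg_shift]
  congr 1
  push_cast
  ring

theorem biderivation_L_zero_left (hf : IsBiderivation f)
    (hl : ∀ n, f (L ε 0) (L ε n) = 0) (hr : ∀ n, f (L ε n) (L ε 0) = 0) (x : SV ε) :
    f (L ε 0) x = 0 := by
  have key (j : SVIndex) : f (L ε 0) (basis ε j) = 0 := by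
    refine ext_coord fun i => ?_
    rw [map_zero]
    by_cases hi : i.slope ≠ 0 ∨ i.deg ε ≠ 0
    · exact coord_biderivation_eq_zero hf hl hr hi j
    · push Not at hi
      -- Only the `M_0`-coordinate is left. With `e_j` written as `c • [L_a, e]`, it is a multiple
      -- of the `M_{-a}`-coordinate of `f(L_0, e)`, which vanishes as `a ≠ 0`.
      obtain ⟨a, c, ha, -, h⟩ := basis_eq_smul_lie (ε := ε) j
      rw [h, map_smul, hf.2, hl, zero_lie, zero_add, map_smul, coord_lie_L,
        coord_biderivation_eq_zero hf hl hr, mul_zero, smul_zero]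
      right
      simpa [hi.2] using ha
  have : f (L ε 0) = 0 := (basis ε).ext key
  rw [this, LinearMap.zero_apply]

/-- A biderivation is zero if its value at `(L_0, L_0)` and one coordinate of its value at
`(L_0, L_1)` are zero. -/
theorem biderivation_eq_zero (hf : IsBiderivation f) (h0 : f (L ε 0) (L ε 0) = 0)
    (h1 : coord (.L 1) (f (L ε 0) (L ε 1)) = 0) : f = 0 := by
  have hL := biderivation_L_eq_zero hf h0 h1
  have hl (x : SV ε) : f (L ε 0) x = 0 :=
    biderivation_L_zero_left hf (fun n => (hL n).1) (fun n => (hL n).2) x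
  have hr (x : SV ε) : f x (L ε 0) = 0 :=
    biderivation_L_zero_left hf.flip (fun n => (hL n).2) (fun n => (hL n).1) x
  have hne (j k : SVIndex) (h : j.deg ε ≠ k.deg ε) : f (basis ε j) (basis ε k) = 0 := by
    refine ext_coord fun i => ?_
    have hj := coord_biderivation_left hf i j (basis ε k)
    have hk := coord_biderivation_right hf i k (basis ε j)
    rw [hl, zero_lie, map_zero] at hj
    rw [hr, zero_lie, map_zero] at hk
    rw [map_zero]
    refine (mul_eq_zero.mp ?_).resolve_left (sub_ne_zero.mpr h)
    linear_combination hk - hj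
  refine (basis ε).ext fun j => (basis ε).ext fun k => ?_
  rw [LinearMap.zero_apply, LinearMap.zero_apply]
  by_cases h : j.deg ε = k.deg ε
  -- Both factors of `[L_a, e]` have a degree different from that of `e_k`: `a ≠ deg k` by `had`,
  -- and `deg k - a ≠ deg k` by `ha`.
  · obtain ⟨a, c, ha, had, hj⟩ := basis_eq_smul_lie (ε := ε) j
    have h2 : f (L ε a) (basis ε k) = 0 := hne (.L a) k (h ▸ had)
    rw [hj, map_smul, LinearMap.smul_apply, hf.1, h2, hne _ k (by simpa [h] using ha), lie_zero,
      zero_lie, add_zero, smul_zero]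
  · exact hne j k h

/-! ### The classification -/

theorem coord_chi_L_zero (μ : ℤ →₀ ℂ) (i : SVIndex) :
    coord i (chi ε μ (L ε 0) (L ε 0)) = match i with | .M m => μ m | _ => 0 := by
  rw [chi_L_L, Finsupp.sum, map_sum]
  cases i with
  | M m =>
    simp only [map_smul, smul_eq_mul, M, zero_add]
    rw [Finset.sum_eq_single m]
    · rw [coord_basis_self, mul_one]
    · intro n _ hn
      rw [coord_basis_ne (by simpa using hn), mul_zero]
    · intro hm
      simpa [coord_basis_self] using hm
  | _ =>
    refine Finset.sum_eq_zero fun n _ => ?_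
    rw [map_smul, M, coord_basis_ne (by simp), smul_zero]

theorem coord_L_chi (μ : ℤ →₀ ℂ) (m n k : ℤ) :
    coord (.L k) (chi ε μ (L ε m) (L ε n)) = 0 := by
  rw [chi_L_L, Finsupp.sum, map_sum]
  refine Finset.sum_eq_zero fun n _ => ?_
  rw [map_smul, M, coord_basis_ne (by simp), smul_zero]

theorem exists_eq_bracket_add_chi (hf : IsBiderivation f) :
    ∃ (c : ℂ) (μ : ℤ →₀ ℂ), f = c • bracketHom ε + chi ε μ := by
  have hinj : Function.Injective SVIndex.M := fun a b h => by simpa using h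
  let μ : ℤ →₀ ℂ := Finsupp.comapDomain SVIndex.M ((basis ε).repr (f (L ε 0) (L ε 0)))
    hinj.injOn
  -- The sign is due to `[L_0, L_1] = -L_1`.
  let c : ℂ := -coord (.L 1) (f (L ε 0) (L ε 1))
  have hbr (n : ℤ) : bracketHom ε (L ε 0) (L ε n) = -(n : ℂ) • L ε n := by
    simpa using! lie_L_L (ε := ε) 0 n
  refine ⟨c, μ, sub_eq_zero.mp (biderivation_eq_zero
    (hf.sub ((isBiderivation_bracketHom.smul c).add (isBiderivation_chi μ))) ?_ ?_)⟩
  · refine ext_coord fun i => ?_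
    simp only [LinearMap.sub_apply, LinearMap.add_apply, LinearMap.smul_apply, hbr, map_sub,
      map_add, coord_chi_L_zero]
    rcases i with m | m | m
    · simp [coord_biderivation_L_zero hf (i := .L m) (by simp [SVIndex.slope])]
    · simp [coord_biderivation_L_zero hf (i := .Y m) (by simp [SVIndex.slope])]
    · simp [μ, coord]
  · simp only [LinearMap.sub_apply, LinearMap.add_apply, LinearMap.smul_apply, hbr, map_sub,
      map_add, coord_L_chi, map_smul]
    rw [show coord (.L 1) (L ε 1) = 1 from coord_basis_self _]
    simp [c]

end SV

theorem theorem3p5 (ε : Eps) :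
    (∀ f : SV ε →ₗ[ℂ] SV ε →ₗ[ℂ] SV ε,
      IsBiderivation f ↔
        ∃ (c : ℂ) (μ : ℤ →₀ ℂ), ∀ x y : SV ε, f x y = c • ⁅x, y⁆ + SV.chi ε μ x y) ∧
    ∃ f : SV ε →ₗ[ℂ] SV ε →ₗ[ℂ] SV ε,
      IsBiderivation f ∧ ¬ IsInnerBiderivation f ∧ ¬ IsSkewSymmetric f := by
  refine ⟨fun f => ⟨fun hf => ?_, ?_⟩,
    -- This map sends `(L_0, L_0)` to `M_0 ≠ 0`, whereas inner and skew-symmetric maps vanish there.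
    SV.chi ε (Finsupp.single 0 1), SV.isBiderivation_chi _, ?_, ?_⟩
  · obtain ⟨c, μ, rfl⟩ := SV.exists_eq_bracket_add_chi hf
    exact ⟨c, μ, fun x y => rfl⟩
  · rintro ⟨c, μ, h⟩
    have : f = c • SV.bracketHom ε + SV.chi ε μ := LinearMap.ext₂ h
    rw [this]
    exact (SV.isBiderivation_bracketHom.smul c).add (SV.isBiderivation_chi μ)
  · rintro ⟨c, h⟩
    have h := congrArg (SV.coord (.M 0)) (h (SV.L ε 0) (SV.L ε 0))
    rw [SV.coord_chi_L_zero, lie_self, smul_zero, map_zero] at h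
    simp at h
  · intro h
    have h := congrArg (SV.coord (.M 0)) (h (SV.L ε 0) (SV.L ε 0))
    rw [map_neg, SV.coord_chi_L_zero, self_eq_neg] at h
    simp at h
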